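/- For integers $n,k\ge 0$, a word $w=w_1w_2\cdots w_n$ avoids a permutation $\sigma=\sigma_1\cdots\sigma_k$ of $\{1,\dots,k\}$ if there are no indices $i_1<i_2<\cdots<i_k$ such that $w_{i_1}w_{i_2}\cdots w_{i_k}$ is order isomorphic to $\sigma$. A permutation $\pi=\pi_1\cdots\pi_n$ of $\{1,\dots,n\}$ is a ballot permutation if no prefix of $\pi$ has more descents ($\pi_i>\pi_{i+1}$) than ascents ($\pi_i<\pi_{i+1}$); let $\mathcal B_n(231)$ be the set of ballot permutations of $\{1,\dots,n\}$ that avoid $231$. For integers $n,h,b\ge 0$, a permutation $\pi$ of $\{1,\dots,n+1\}$ is an $(h,b)$-ballot permutation if the lattice path that starts at $(0,h)$ and whose $i$-th step, for $1\le i\le n$, is $(1,1)$ if $\pi_i<\pi_{i+1}$ and $(1,-1)$ if $\pi_i>\pi_{i+1}$, never passes below the $x$-axis and ends at $(n,b)$. An $n$-step Gouyou-Beauchamps walk is a lattice walk with $n$ steps, each one of $(0,1),(0,-1),(-1,0),(1,0)$, all of whose vertices $(x,y)$ satisfy $0\le y\le x$. Theorem. For all integers $n,h,b\ge 0$, the number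 of $231$-avoiding $(h,b)$-ballot permutations of $\{1,\dots,n+1\}$ equals the number of $n$-step Gouyou-Beauchamps walks that start at $(h,0)$ and end at $(b,0)$. In particular, for every integer $n\ge 0$, $$|\mathcal B_n(231)|=C(\lfloor n/2\rfloor)\,C(\lfloor (n+1)/2\rfloor),$$ where $C(m)=\frac{1}{m+1}\binom{2m}{m}$ is the $m$-th Catalan number. -/

import Mathlib

/-- The word `w` avoids the pattern `σ = σ₁σ₂⋯σₖ`: no subword `w_{i₁}w_{i₂}⋯w_{iₖ}` with
`i₁ < i₂ < ⋯ < iₖ` is order isomorphic to `σ`. -/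
def AvoidsPattern {α : Type*} [LinearOrder α] {n k : ℕ} (w : Fin n → α)
    (σ : Equiv.Perm (Fin k)) : Prop :=
  ¬ ∃ i : Fin k → Fin n, StrictMono i ∧ ∀ r s : Fin k, w (i r) < w (i s) ↔ σ r < σ s

/-- The permutation with one-line notation `2 3 1` (letters are shifted to `0, 1, 2`). -/
def pattern231 : Equiv.Perm (Fin 3) where
  toFun := ![1, 2, 0]
  invFun := ![2, 0, 1]
  left_inv := by decide
  right_inv := by decide

/-- Number of ascents in the prefix of length `k` of `π`. -/
def prefixAsc {n : ℕ} (π : Equiv.Perm (Fin n)) (k : ℕ) : ℕ :=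
  (Finset.univ.filter fun i : Fin n =>
    ∃ hi : i.val + 1 < n, i.val + 1 < k ∧ π i < π ⟨i.val + 1, hi⟩).card

/-- Number of descents in the prefix of length `k` of `π`. -/
def prefixDes {n : ℕ} (π : Equiv.Perm (Fin n)) (k : ℕ) : ℕ :=
  (Finset.univ.filter fun i : Fin n =>
    ∃ hi : i.val + 1 < n, i.val + 1 < k ∧ π ⟨i.val + 1, hi⟩ < π i).card

/-- Ballot permutations: no prefix has more descents than ascents. -/
def IsBallotPerm {n : ℕ} (π : Equiv.Perm (Fin n)) : Prop :=
  ∀ k : ℕ, k ≤ n → prefixDes π k ≤ prefixAsc π k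

/-- The ordinate, after `k` steps, of the lattice path that starts at `(0, h)` and whose successive
steps are `(1, 1)` at an ascent and `(1, -1)` at a descent of `π`. -/
def ascDesHeight {n : ℕ} (h : ℕ) (π : Equiv.Perm (Fin (n + 1))) (k : Fin (n + 1)) : ℤ :=
  h + ∑ i : Fin n,
    if i.val < k.val then (if π i.castSucc < π i.succ then 1 else -1) else 0

/-- `(h, b)`-ballot permutations of length `n + 1`: the associated path from `(0, h)` never goes
below the `x`-axis and ends at `(n, b)`. -/
def IsHBBallotPerm {n : ℕ} (h b : ℕ) (π : Equiv.Perm (Fin (n + 1))) : Prop :=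
  (∀ k : Fin (n + 1), 0 ≤ ascDesHeight h π k) ∧ ascDesHeight h π (Fin.last n) = b

/-- The set `{↑, ↓, ←, →}` of steps. -/
def gbSteps : Set (ℤ × ℤ) := {(0, 1), (0, -1), (-1, 0), (1, 0)}

/-- An `n`-step Gouyou-Beauchamps walk, as its sequence of vertices: it stays in the quarter plane,
weakly below the diagonal `y = x`, and uses only the steps `↑, ↓, ←, →`. -/
def IsGBWalk {n : ℕ} (w : Fin (n + 1) → ℤ × ℤ) : Prop :=
  (∀ k : Fin (n + 1), 0 ≤ (w k).1 ∧ 0 ≤ (w k).2 ∧ (w k).2 ≤ (w k).1) ∧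
    ∀ k : Fin n, w k.succ - w k.castSucc ∈ gbSteps

/-- The `n`-step Gouyou-Beauchamps walks that start at `(h, 0)` and end at `(b, 0)`. -/
def gbWalks (n h b : ℕ) : Set (Fin (n + 1) → ℤ × ℤ) :=
  {w | IsGBWalk w ∧ w 0 = ((h : ℤ), 0) ∧ w (Fin.last n) = ((b : ℤ), 0)}

/-- The set of `231`-avoiding `(h, b)`-ballot permutations of length `n + 1`. -/
def hbBallotPerms231 (n h b : ℕ) : Set (Equiv.Perm (Fin (n + 1))) :=
  {π | IsHBBallotPerm h b π ∧ AvoidsPattern π pattern231}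

/-- The set of `231`-avoiding ballot permutations of length `n`. -/
def ballotPerms231 (n : ℕ) : Set (Equiv.Perm (Fin n)) :=
  {π | IsBallotPerm π ∧ AvoidsPattern π pattern231}

/-! Permutations are built by prepending letters. Prepending `a` to a 231-avoiding `π` keeps it
231-avoiding exactly when the first `a` letters of `π` are its `a` smallest, that is, `π` has a cut
at `a` (`avoidsPattern231_consFin`). The letter `0` creates an ascent and one more positive cut; a
positive cut creates a descent, and from `c` positive cuts these choices leave `1, ..., c` of them,
once each. Weight each permutation by `(c - 1).choose y`. The hockey-stick identity and Pascal's
rule turn this generating tree into a four-term recurrence, which is the first-step recurrence for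
Gouyou-Beauchamps walks starting at `(h + y, y)` (`cutWeight_eq_numGBWalks`); `y = 0` gives the
equinumerosity. For the Catalan product, the coordinates `x - y` and `x + y + 2` turn a walk into
two noncrossing nonnegative paths, counted by a 2 by 2 determinant (`numGBWalks_eq_det`). From the
origin its sum over endpoints telescopes (`sum_numGBWalks_origin`), and parity leaves a product of
two Catalan numbers. -/

open Finset

/-! ### Prepending a letter and avoiding 231. -/

/-- The permutation whose one-line notation is `a` followed by that of `π`, the letters of `π` that
are at least `a` being increased by one. -/
def consFin {n : ℕ} (a : Fin (n + 1)) (π : Equiv.Perm (Fin n)) : Equiv.Perm (Fin (n + 1)) :=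
  (finSuccEquiv' 0).trans (π.optionCongr.trans (finSuccEquiv' a).symm)

@[simp]
theorem consFin_zero {n : ℕ} (a : Fin (n + 1)) (π : Equiv.Perm (Fin n)) : consFin a π 0 = a := by
  simp [consFin]

@[simp]
theorem consFin_succ {n : ℕ} (a : Fin (n + 1)) (π : Equiv.Perm (Fin n)) (i : Fin n) :
    consFin a π i.succ = a.succAbove (π i) := by
  have : finSuccEquiv' (0 : Fin (n + 1)) i.succ = some i := by
    rw [← Fin.succAbove_zero, finSuccEquiv'_succAbove]
  simp [consFin, this]

theorem consFin_bijective (n : ℕ) :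
    Function.Bijective fun p : Fin (n + 1) × Equiv.Perm (Fin n) => consFin p.1 p.2 := by
  rw [Fintype.bijective_iff_injective_and_card]
  constructor
  · rintro ⟨a, π⟩ ⟨c, τ⟩ h
    have h0 : a = c := by simpa using congrArg (fun σ : Equiv.Perm (Fin (n + 1)) => σ 0) h
    subst h0
    refine Prod.ext rfl (Equiv.ext fun i => ?_)
    have := congrArg (fun σ : Equiv.Perm (Fin (n + 1)) => σ i.succ) h
    simpa using this
  · simp [Fintype.card_perm, Nat.factorial_succ]

theorem sum_perm_fin_succ {n : ℕ} {M : Type*} [AddCommMonoid M]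
    (f : Equiv.Perm (Fin (n + 1)) → M) :
    ∑ σ, f σ = ∑ π : Equiv.Perm (Fin n), ∑ a, f (consFin a π) := by
  rw [sum_comm, ← Fintype.sum_prod_type']
  exact (Function.Bijective.sum_comp (consFin_bijective n) f).symm

/-- The first `m` letters of `π` are the `m` smallest ones. -/
def IsCut {n : ℕ} (π : Equiv.Perm (Fin n)) (m : ℕ) : Prop :=
  ∀ i : Fin n, i.val < m → (π i).val < m

/-- An injection of a finite set of positions into itself is onto, so no later position can hold a
small letter. -/
theorem IsCut.lt_iff {n m : ℕ} {π : Equiv.Perm (Fin n)} (h : IsCut π m) (i : Fin n) :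
    (π i).val < m ↔ i.val < m := by
  refine ⟨fun hi => ?_, h i⟩
  set s : Finset (Fin n) := univ.filter fun i => i.val < m with hs
  have hsub : s.map π.toEmbedding ⊆ s := by
    intro j hj
    simp only [mem_map, hs, mem_filter, mem_univ, true_and] at hj ⊢
    obtain ⟨k, hk, rfl⟩ := hj
    exact h k hk
  have heq := eq_of_subset_of_card_le hsub (by simp)
  have : π i ∈ s.map π.toEmbedding := by rw [heq]; simpa [hs] using hi
  simpa [hs] using this

theorem avoidsPattern231_iff {n : ℕ} (π : Equiv.Perm (Fin n)) :
    AvoidsPattern π pattern231 ↔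
      ∀ i j k : Fin n, i < j → j < k → π k < π i → ¬ π i < π j := by
  constructor
  · intro h i j k hij hjk hki hlt
    refine h ⟨![i, j, k], ?_, ?_⟩
    · rw [Fin.strictMono_iff_lt_succ]
      intro r
      fin_cases r <;> simpa
    · intro r s
      fin_cases r <;> fin_cases s <;>
        simp [pattern231, hki, hlt, hki.trans hlt, hki.le, hlt.le, (hki.trans hlt).le]
  · rintro h ⟨f, hf, hfs⟩
    refine h (f 0) (f 1) (f 2) (hf (by decide)) (hf (by decide)) ?_ ?_
    · rw [hfs]; decide
    · rw [hfs]; decide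

theorem avoidsPattern231_consFin {n : ℕ} (a : Fin (n + 1)) (π : Equiv.Perm (Fin n)) :
    AvoidsPattern (consFin a π) pattern231 ↔ AvoidsPattern π pattern231 ∧ IsCut π a := by
  simp only [avoidsPattern231_iff]
  constructor
  · intro h
    refine ⟨fun i j k hij hjk hki hlt => ?_, ?_⟩
    · refine h i.succ j.succ k.succ (by simpa) (by simpa) ?_ ?_ <;>
        simpa [Fin.succAbove_lt_succAbove_iff]
    · by_contra hc
      simp only [IsCut, not_forall, not_lt] at hc
      obtain ⟨i, hia, hai⟩ := hc
      -- The letter at `i` is too large. A value `v < a` at a position at least `a` would lie to its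
      -- right, and `a`, this large letter, `v` would form 231.
      have hinv : IsCut π.symm a := by
        intro v hv
        by_contra hva
        rw [not_lt] at hva
        refine h 0 i.succ (π.symm v).succ (by simp) ?_ ?_ ?_
        · rw [Fin.succ_lt_succ_iff, Fin.lt_def]; omega
        · simp [Fin.succAbove, Fin.lt_def, hv]
        · simp [Fin.succAbove, Fin.lt_def, not_lt.mpr hai]; omega
      have := (hinv.lt_iff (π i)).1 (by simpa using hia)
      omega
  · rintro ⟨h, hc⟩ i j k hij hjk hki hlt
    obtain ⟨j, rfl⟩ := Fin.exists_succ_eq.2 (Fin.ne_zero_of_lt hij)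
    obtain ⟨k, rfl⟩ := Fin.exists_succ_eq.2 (Fin.ne_zero_of_lt hjk)
    rw [Fin.succ_lt_succ_iff] at hjk
    refine Fin.cases ?_ (fun i => ?_) i hij hki hlt
    · intro _ hki hlt
      simp only [consFin_zero, consFin_succ] at hki hlt
      have hk := hc.lt_iff k
      have hj := hc.lt_iff j
      simp only [Fin.lt_def] at hjk
      simp only [Fin.succAbove, Fin.lt_def] at hki hlt
      split_ifs at hki hlt <;> simp at * <;> omega
    · intro hij hki hlt
      simp only [consFin_succ, Fin.succAbove_lt_succAbove_iff, Fin.succ_lt_succ_iff] at hij hki hlt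
      exact h i j k hij hjk hki hlt

/-! ### Cuts and the generating tree. -/

open Classical in
/-- The cuts of `π` at positive positions, each shifted down by one. -/
noncomputable def cuts {n : ℕ} (π : Equiv.Perm (Fin n)) : Finset (Fin n) :=
  univ.filter fun m => IsCut π (m + 1)

theorem mem_cuts {n : ℕ} {π : Equiv.Perm (Fin n)} {m : Fin n} :
    m ∈ cuts π ↔ IsCut π (m + 1) := by
  simp [cuts]

/-- The full word is a cut, so `#(cuts π) - 1` is never truncated below. -/
theorem card_cuts_pos {n : ℕ} (π : Equiv.Perm (Fin (n + 1))) : 0 < #(cuts π) :=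
  card_pos.2 ⟨Fin.last n, mem_cuts.2 fun _ _ => (π _).isLt⟩

theorem isCut_consFin {n : ℕ} (a : Fin (n + 1)) (π : Equiv.Perm (Fin n)) (m : ℕ) :
    IsCut (consFin a π) (m + 1) ↔ a.val ≤ m ∧ IsCut π m := by
  constructor
  · intro h
    have h0 : a.val ≤ m := by simpa [Nat.lt_succ_iff] using h 0 (by simp)
    refine ⟨h0, fun i hi => ?_⟩
    have := h i.succ (by simpa using hi)
    simp only [consFin_succ, Fin.succAbove, Fin.lt_def] at this
    split_ifs at this <;> simp at * <;> omega
  · rintro ⟨ha, h⟩ i hi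
    refine Fin.cases (fun _ => ?_) (fun i hi => ?_) i hi
    · simpa using Nat.lt_succ_of_le ha
    · have := h i (by simpa using hi)
      simp only [consFin_succ, Fin.succAbove, Fin.lt_def]
      split_ifs <;> simp <;> omega

theorem card_cuts_consFin_zero {n : ℕ} (π : Equiv.Perm (Fin n)) :
    #(cuts (consFin 0 π)) = #(cuts π) + 1 := by
  have : cuts (consFin 0 π) = Finset.cons 0 ((cuts π).map (Fin.succEmb n))
      (by simp) := by
    ext m
    refine Fin.cases ?_ (fun m => ?_) m
    · simp [mem_cuts, IsCut]
    · simp [mem_cuts, isCut_consFin]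
  rw [this, card_cons, card_map]

theorem card_cuts_consFin_succ {n : ℕ} (a : Fin n) (π : Equiv.Perm (Fin n)) :
    #(cuts (consFin a.succ π)) = #{m ∈ cuts π | a ≤ m} := by
  have : cuts (consFin a.succ π) =
      ({m ∈ cuts π | a ≤ m}).map (Fin.succEmb n) := by
    ext m
    refine Fin.cases ?_ (fun m => ?_) m
    · simp [mem_cuts, isCut_consFin]
    · simp [mem_cuts, isCut_consFin, and_comm]
  rw [this, card_map]

/-- The upper sections of `s` at its elements have sizes `1, ..., #s`, each once. -/
theorem sum_card_filter_le {α M : Type*} [LinearOrder α] [AddCommMonoid M] (s : Finset α)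
    (f : ℕ → M) : ∑ a ∈ s, f #{m ∈ s | a ≤ m} = ∑ i ∈ range #s, f (i + 1) := by
  induction s using Finset.induction_on_min with
  | empty => simp
  | insert a s ha ih =>
    have has : a ∉ s := fun h => lt_irrefl a (ha a h)
    rw [sum_insert has, card_insert_of_notMem has, sum_range_succ, ← ih, add_comm]
    congr 1
    · refine sum_congr rfl fun x hx => ?_
      rw [filter_insert, if_neg (ha x hx).not_ge]
    · rw [filter_true_of_mem, card_insert_of_notMem has]
      simpa using fun x hx => (ha x hx).le

theorem sum_range_choose_fixed (k y : ℕ) : ∑ i ∈ range k, i.choose y = k.choose (y + 1) := by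
  induction k with
  | zero => simp
  | succ k ih => rw [sum_range_succ, ih, Nat.choose_succ_succ, add_comm]

theorem sum_cuts_choose {n : ℕ} (π : Equiv.Perm (Fin n)) (y : ℕ) :
    ∑ a ∈ cuts π, (#(cuts (consFin a.succ π)) - 1).choose y = (#(cuts π)).choose (y + 1) := by
  simp only [card_cuts_consFin_succ]
  rw [sum_card_filter_le (cuts π) fun i => (i - 1).choose y]
  simpa using sum_range_choose_fixed _ y

/-! ### Effect of prepending on the lattice path. -/

theorem ascDesHeight_consFin_succ {n : ℕ} (h : ℕ) (a : Fin (n + 2)) (π : Equiv.Perm (Fin (n + 1)))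
    (k : Fin (n + 1)) :
    ascDesHeight h (consFin a π) k.succ =
      ascDesHeight h π k + if a < a.succAbove (π 0) then 1 else -1 := by
  have h0 : (1 : Fin (n + 2)) = (0 : Fin (n + 1)).succ := rfl
  simp only [ascDesHeight, Fin.sum_univ_succ, Fin.castSucc_zero, consFin_zero, consFin_succ,
    ← Fin.succ_castSucc, Fin.succAbove_lt_succAbove_iff, Fin.val_succ, Fin.val_zero,
    Nat.succ_lt_succ_iff, Nat.succ_pos, if_true]
  ring

theorem ascDesHeight_zero {n : ℕ} (h : ℕ) (π : Equiv.Perm (Fin (n + 1))) :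
    ascDesHeight h π 0 = h := by
  simp [ascDesHeight]

theorem ascDesHeight_add {n : ℕ} (h c : ℕ) (π : Equiv.Perm (Fin (n + 1))) (k : Fin (n + 1)) :
    ascDesHeight (h + c) π k = ascDesHeight h π k + c := by
  simp [ascDesHeight]; ring

theorem isHBBallotPerm_consFin_zero {n : ℕ} (h b : ℕ) (π : Equiv.Perm (Fin (n + 1))) :
    IsHBBallotPerm h b (consFin 0 π) ↔ IsHBBallotPerm (h + 1) b π := by
  simp only [IsHBBallotPerm, Fin.forall_fin_succ (n := n + 1), ← Fin.succ_last,
    ascDesHeight_consFin_succ, ascDesHeight_zero, ascDesHeight_add]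
  simp

theorem isHBBallotPerm_consFin_succ {n : ℕ} (h b : ℕ) (π : Equiv.Perm (Fin (n + 1)))
    {a : Fin (n + 1)} (ha : a ∈ cuts π) :
    IsHBBallotPerm h b (consFin a.succ π) ↔ ∃ h', h = h' + 1 ∧ IsHBBallotPerm h' b π := by
  -- The cut forces `π 0` below `a.succ`, so the first step is a descent.
  have hlt : ¬ a.succ < a.succ.succAbove (π 0) := by
    have := mem_cuts.1 ha 0 (by simp)
    simp only [Fin.succAbove, Fin.lt_def]
    split_ifs <;> simp at * <;> omega
  simp only [IsHBBallotPerm, Fin.forall_fin_succ (n := n + 1), ← Fin.succ_last,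
    ascDesHeight_consFin_succ, ascDesHeight_zero, if_neg hlt]
  cases h with
  | zero =>
    simp only [Nat.right_eq_add, Nat.add_eq_zero_iff, one_ne_zero, and_false, false_and,
      exists_false, iff_false]
    rintro ⟨⟨_, h⟩, _⟩
    have := h 0
    rw [ascDesHeight_zero] at this
    simp at this
  | succ h =>
    simp only [ascDesHeight_add, add_left_inj, exists_eq_left']
    simp
    omega

/-! ### Recurrences for the weighted counts. -/

open Classical in
/-- The `231`-avoiding `(h, b)`-ballot permutations, weighted by a binomial coefficient in the number
of their cuts. -/
noncomputable def cutWeight (n h b y : ℕ) : ℕ :=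
  ∑ π : Equiv.Perm (Fin (n + 1)) with π ∈ hbBallotPerms231 n h b, (#(cuts π) - 1).choose y

theorem cutWeight_zero_right (n h b : ℕ) :
    cutWeight n h b 0 = (hbBallotPerms231 n h b).ncard := by
  classical
  simp only [cutWeight, Nat.choose_zero_right, sum_const, smul_eq_mul, mul_one]
  rw [Set.ncard_eq_toFinset_card']
  congr 1
  ext
  simp

open Classical in
theorem cutWeight_succ_eq (n h b y : ℕ) :
    cutWeight (n + 1) h b y =
      (∑ π : Equiv.Perm (Fin (n + 1)) with π ∈ hbBallotPerms231 n (h + 1) b,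
        (#(cuts π)).choose y) +
      ∑ π : Equiv.Perm (Fin (n + 1)) with ∃ h', h = h' + 1 ∧ π ∈ hbBallotPerms231 n h' b,
        (#(cuts π)).choose (y + 1) := by
  simp only [cutWeight, sum_filter]
  rw [sum_perm_fin_succ, ← sum_add_distrib]
  refine sum_congr rfl fun π _ => ?_
  rw [Fin.sum_univ_succ]
  congr 1
  · have hc : IsCut π 0 := fun i hi => absurd hi (by simp)
    have key : consFin 0 π ∈ hbBallotPerms231 (n + 1) h b ↔ π ∈ hbBallotPerms231 n (h + 1) b := by
      simp [hbBallotPerms231, isHBBallotPerm_consFin_zero, avoidsPattern231_consFin, hc]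
    simp only [key, card_cuts_consFin_zero, Nat.add_sub_cancel]
  · have key : ∀ a : Fin (n + 1), consFin a.succ π ∈ hbBallotPerms231 (n + 1) h b ↔
        a ∈ cuts π ∧ ∃ h', h = h' + 1 ∧ π ∈ hbBallotPerms231 n h' b := by
      intro a
      simp only [hbBallotPerms231, Set.mem_ofPred_eq, avoidsPattern231_consFin]
      constructor
      · rintro ⟨h1, h2, h3⟩
        have ha : a ∈ cuts π := mem_cuts.2 h3
        obtain ⟨h', rfl, h4⟩ := (isHBBallotPerm_consFin_succ h b π ha).1 h1
        exact ⟨ha, h', rfl, h4, h2⟩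
      · rintro ⟨ha, h', rfl, h4, h2⟩
        exact ⟨(isHBBallotPerm_consFin_succ _ b π ha).2 ⟨h', rfl, h4⟩, h2, mem_cuts.1 ha⟩
    simp only [key]
    split_ifs with hP
    · simp only [hP, and_true]
      rw [← sum_cuts_choose, ← sum_filter]
      simp
    · simp [hP]

theorem cutWeight_zero (h b y : ℕ) : cutWeight 0 h b y = if h = b ∧ y = 0 then 1 else 0 := by
  classical
  have hcard : ∀ π : Equiv.Perm (Fin 1), #(cuts π) = 1 := fun π =>
    le_antisymm (by simpa using card_le_univ (cuts π)) (card_cuts_pos π)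
  have hmem : ∀ π : Equiv.Perm (Fin 1), π ∈ hbBallotPerms231 0 h b ↔ h = b := by
    intro π
    simp only [hbBallotPerms231, IsHBBallotPerm, ascDesHeight, avoidsPattern231_iff,
      Set.mem_ofPred_eq]
    simp [Subsingleton.elim _ (0 : Fin 1)]
  simp only [cutWeight, hcard, hmem, sum_filter]
  cases y <;> simp [Nat.choose_zero_succ]

theorem cutWeight_succ_zero (n h b : ℕ) :
    cutWeight (n + 1) h b 0 = cutWeight n (h + 1) b 0 +
      if h = 0 then 0 else cutWeight n (h - 1) b 0 + cutWeight n (h - 1) b 1 := by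
  classical
  rw [cutWeight_succ_eq]
  congr 1
  · simp [cutWeight]
  · cases h with
    | zero => simp
    | succ h =>
      simp only [cutWeight, add_left_inj, exists_eq_left', ← sum_add_distrib, Nat.add_eq_zero_iff,
        one_ne_zero, and_false, if_false, Nat.add_sub_cancel]
      refine sum_congr rfl fun π _ => ?_
      obtain ⟨k, hk⟩ := Nat.exists_eq_add_of_lt (card_cuts_pos π)
      simp [hk, add_comm]

theorem cutWeight_succ_succ (n h b y : ℕ) :
    cutWeight (n + 1) h b (y + 1) = cutWeight n (h + 1) b y + cutWeight n (h + 1) b (y + 1) +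
      if h = 0 then 0 else cutWeight n (h - 1) b (y + 1) + cutWeight n (h - 1) b (y + 2) := by
  classical
  rw [cutWeight_succ_eq]
  congr 1
  · simp only [cutWeight, ← sum_add_distrib]
    refine sum_congr rfl fun π _ => ?_
    obtain ⟨k, hk⟩ := Nat.exists_eq_add_of_lt (card_cuts_pos π)
    simp [hk, Nat.choose_succ_succ]
  · cases h with
    | zero => simp
    | succ h =>
      simp only [cutWeight, add_left_inj, exists_eq_left', ← sum_add_distrib, Nat.add_eq_zero_iff,
        one_ne_zero, and_false, if_false, Nat.add_sub_cancel]
      refine sum_congr rfl fun π _ => ?_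
      obtain ⟨k, hk⟩ := Nat.exists_eq_add_of_lt (card_cuts_pos π)
      simp [hk, Nat.choose_succ_succ]

/-! ### Gouyou-Beauchamps walks and their first-step recurrence. -/

/-- The number of `n`-step Gouyou-Beauchamps walks from `p` to `(b, 0)`. -/
noncomputable def numGBWalks (n : ℕ) (p : ℤ × ℤ) (b : ℕ) : ℕ :=
  {w : Fin (n + 1) → ℤ × ℤ | IsGBWalk w ∧ w 0 = p ∧ w (Fin.last n) = ((b : ℤ), 0)}.ncard

/-- The wedge `0 ≤ y ≤ x`. -/
def InGBWedge (p : ℤ × ℤ) : Prop := 0 ≤ p.1 ∧ 0 ≤ p.2 ∧ p.2 ≤ p.1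

instance : DecidablePred InGBWedge := fun p => by unfold InGBWedge; infer_instance

/-- The vertex sequences of the `n`-step Gouyou-Beauchamps walks from `p` to `(b, 0)`. -/
def gbWalkFinset (b : ℕ) : (n : ℕ) → ℤ × ℤ → Finset (Fin (n + 1) → ℤ × ℤ)
  | 0, p => if InGBWedge p ∧ p = ((b : ℤ), 0) then {fun _ => p} else ∅
  | n + 1, p =>
    if InGBWedge p then
      ({(0, 1), (0, -1), (-1, 0), (1, 0)} : Finset (ℤ × ℤ)).biUnion fun s =>
        (gbWalkFinset b n (p + s)).image (Fin.cons (α := fun _ => ℤ × ℤ) p)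
    else ∅

theorem isGBWalk_cons {n : ℕ} (p : ℤ × ℤ) (w : Fin (n + 1) → ℤ × ℤ) :
    IsGBWalk (Fin.cons p w : Fin (n + 2) → ℤ × ℤ) ↔
      InGBWedge p ∧ w 0 - p ∈ gbSteps ∧ IsGBWalk w := by
  simp only [IsGBWalk, Fin.forall_fin_succ (n := n + 1), Fin.forall_fin_succ (n := n),
    Fin.cons_zero, Fin.cons_succ, Fin.castSucc_zero, ← Fin.succ_castSucc, InGBWedge]
  tauto

theorem mem_gbWalkFinset {b n : ℕ} {p : ℤ × ℤ} {w : Fin (n + 1) → ℤ × ℤ} :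
    w ∈ gbWalkFinset b n p ↔ IsGBWalk w ∧ w 0 = p ∧ w (Fin.last n) = ((b : ℤ), 0) := by
  induction n generalizing p with
  | zero =>
    simp only [gbWalkFinset, IsGBWalk, Fin.last_zero]
    split_ifs with h
    · obtain ⟨h, rfl⟩ := h
      rw [mem_singleton]
      constructor
      · rintro rfl
        exact ⟨⟨fun _ => h, fun k => k.elim0⟩, rfl, rfl⟩
      · rintro ⟨-, h0, -⟩
        funext k
        rw [Fin.fin_one_eq_zero k, h0]
    · simp only [notMem_empty, false_iff]
      rintro ⟨⟨h1, -⟩, rfl, h2⟩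
      exact h ⟨h1 0, h2⟩
  | succ n ih =>
    refine Fin.consCases (fun q w => ?_) w
    rw [isGBWalk_cons, ← Fin.succ_last, Fin.cons_zero, Fin.cons_succ, gbWalkFinset]
    split_ifs with h
    · simp only [mem_biUnion, mem_image, ih]
      constructor
      · rintro ⟨s, hs, w', ⟨h1, h2, h3⟩, hw⟩
        obtain ⟨rfl, rfl⟩ := Fin.cons_inj.1 hw
        refine ⟨⟨h, ?_, h1⟩, rfl, h3⟩
        rw [h2, add_sub_cancel_left]
        simpa [gbSteps] using hs
      · rintro ⟨⟨-, h1, h2⟩, rfl, h3⟩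
        exact ⟨w 0 - q, by simpa [gbSteps] using h1, w, ⟨h2, by simp, h3⟩, rfl⟩
    · simp only [notMem_empty, false_iff]
      rintro ⟨⟨h1, -⟩, rfl, -⟩
      exact h h1

/-- This makes the set of walks finite, so its `ncard` is not a default value. -/
theorem setOf_gbWalk_eq (n : ℕ) (p : ℤ × ℤ) (b : ℕ) :
    {w : Fin (n + 1) → ℤ × ℤ | IsGBWalk w ∧ w 0 = p ∧ w (Fin.last n) = ((b : ℤ), 0)} =
      gbWalkFinset b n p := by
  ext w
  exact mem_gbWalkFinset.symm

theorem numGBWalks_eq_card (n : ℕ) (p : ℤ × ℤ) (b : ℕ) :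
    numGBWalks n p b = #(gbWalkFinset b n p) := by
  rw [numGBWalks, setOf_gbWalk_eq, Set.ncard_coe_finset]

theorem encard_gbWalks (n h b : ℕ) : (gbWalks n h b).encard = numGBWalks n ((h : ℤ), 0) b := by
  rw [numGBWalks_eq_card, gbWalks, setOf_gbWalk_eq, Set.encard_coe_eq_coe_finsetCard]

theorem numGBWalks_of_not_inGBWedge {p : ℤ × ℤ} (hp : ¬ InGBWedge p) (n b : ℕ) :
    numGBWalks n p b = 0 := by
  rw [numGBWalks_eq_card]
  cases n <;> simp [gbWalkFinset, hp]

theorem numGBWalks_zero {p : ℤ × ℤ} (hp : InGBWedge p) (b : ℕ) :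
    numGBWalks 0 p b = if p = ((b : ℤ), 0) then 1 else 0 := by
  rw [numGBWalks_eq_card, gbWalkFinset]
  simp only [hp, true_and]
  split_ifs <;> simp

theorem numGBWalks_succ {p : ℤ × ℤ} (hp : InGBWedge p) (n b : ℕ) :
    numGBWalks (n + 1) p b = numGBWalks n (p + (0, 1)) b + numGBWalks n (p + (0, -1)) b +
      numGBWalks n (p + (-1, 0)) b + numGBWalks n (p + (1, 0)) b := by
  simp only [numGBWalks_eq_card]
  rw [gbWalkFinset, if_pos hp, card_biUnion]
  · simp only [card_image_of_injective _ (Fin.cons_right_injective (α := fun _ => ℤ × ℤ) p)]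
    rw [sum_insert (by decide), sum_insert (by decide), sum_insert (by decide), sum_singleton]
    ring
  · intro s _ t _ hst
    simp only [Function.onFun, disjoint_left, mem_image, not_exists, not_and]
    rintro _ ⟨w, hw, rfl⟩ w' hw' h
    obtain rfl := (Fin.cons_inj.1 h).2
    rw [mem_gbWalkFinset] at hw hw'
    exact hst (add_left_cancel (hw.2.1.symm.trans hw'.2.1))

theorem cutWeight_eq_numGBWalks (n h b y : ℕ) :
    cutWeight n h b y = numGBWalks n ((h : ℤ) + y, (y : ℤ)) b := by
  induction n generalizing h y with
  | zero =>
    rw [cutWeight_zero, numGBWalks_zero (by simp [InGBWedge]; omega)]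
    congr 1
    simp only [Prod.mk.injEq, eq_iff_iff]
    omega
  | succ n ih =>
    rw [numGBWalks_succ (by simp [InGBWedge]; omega)]
    -- In the coordinates `(x - y, y)`, up and left lower `h` (leaving the wedge when `h = 0`),
    -- while right and down raise it.
    have up : numGBWalks n (((h : ℤ) + y, (y : ℤ)) + (0, 1)) b =
        if h = 0 then 0 else cutWeight n (h - 1) b (y + 1) := by
      split_ifs with h0
      · exact numGBWalks_of_not_inGBWedge (by simp [InGBWedge, h0]) _ _
      · rw [ih]; congr 1; ext <;> push_cast [Nat.one_le_iff_ne_zero.2 h0] <;> simp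
    have left : numGBWalks n (((h : ℤ) + y, (y : ℤ)) + (-1, 0)) b =
        if h = 0 then 0 else cutWeight n (h - 1) b y := by
      split_ifs with h0
      · exact numGBWalks_of_not_inGBWedge (by simp [InGBWedge, h0]) _ _
      · rw [ih]; congr 1; ext <;> push_cast [Nat.one_le_iff_ne_zero.2 h0] <;> simp; ring
    have right : numGBWalks n (((h : ℤ) + y, (y : ℤ)) + (1, 0)) b = cutWeight n (h + 1) b y := by
      rw [ih]; congr 1; ext <;> simp; ring
    rw [up, left, right]
    cases y with
    | zero =>
      rw [numGBWalks_of_not_inGBWedge (p := _ + (0, -1)) (by simp [InGBWedge]), cutWeight_succ_zero]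
      simp only [Nat.zero_add, Nat.add_assoc]
      split_ifs <;> omega
    | succ y =>
      have down : numGBWalks n (((h : ℤ) + (y + 1 : ℕ), ((y + 1 : ℕ) : ℤ)) + (0, -1)) b =
          cutWeight n (h + 1) b y := by
        rw [ih]; congr 1; ext <;> simp; ring
      rw [down, cutWeight_succ_succ]
      simp only [Nat.add_assoc, Nat.reduceAdd]
      split_ifs <;> omega

theorem ncard_hbBallotPerms231 (n h b : ℕ) :
    (hbBallotPerms231 n h b).ncard = numGBWalks n ((h : ℤ), 0) b := by
  rw [← cutWeight_zero_right, cutWeight_eq_numGBWalks]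
  simp

/-! ### Nonnegative paths by the reflection principle. -/

/-- The number of `n`-step paths on `ℤ` from `0` to `k` with steps `±1`. -/
def numFreePaths : ℕ → ℤ → ℤ
  | 0, k => if k = 0 then 1 else 0
  | n + 1, k => numFreePaths n (k + 1) + numFreePaths n (k - 1)

theorem numFreePaths_neg (n : ℕ) (k : ℤ) : numFreePaths n (-k) = numFreePaths n k := by
  induction n generalizing k with
  | zero => simp [numFreePaths]
  | succ n ih =>
    rw [numFreePaths, numFreePaths, ← ih (k + 1), ← ih (k - 1), add_comm]
    ring_nf

theorem numFreePaths_of_lt {n : ℕ} {k : ℤ} (h : (n : ℤ) < k) : numFreePaths n k = 0 := by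
  induction n generalizing k with
  | zero => rw [numFreePaths, if_neg]; push_cast at h; omega
  | succ n ih => push_cast at h; rw [numFreePaths, ih (by omega), ih (by omega), add_zero]

theorem numFreePaths_eq_choose (n a : ℕ) : numFreePaths n (2 * a - n) = n.choose a := by
  induction n generalizing a with
  | zero => cases a <;> simp [numFreePaths]; omega
  | succ n ih =>
    have h1 : (2 * a - (n + 1 : ℕ) + 1 : ℤ) = 2 * a - n := by push_cast; ring
    rw [numFreePaths, h1, ih]
    cases a with
    | zero => rw [← numFreePaths_neg, numFreePaths_of_lt] <;> simp; omega
    | succ a =>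
      have h2 : (2 * (a + 1 : ℕ) - (n + 1 : ℕ) - 1 : ℤ) = 2 * a - n := by push_cast; ring
      rw [h2, ih, Nat.choose_succ_succ]
      push_cast
      ring

theorem numFreePaths_of_odd {n : ℕ} {k : ℤ} (h : Odd (n + k)) : numFreePaths n k = 0 := by
  induction n generalizing k with
  | zero => rw [numFreePaths, if_neg]; rintro rfl; simp at h
  | succ n ih =>
    push_cast at h
    rw [numFreePaths, ih (by (convert h using 1; ring)), ih, add_zero]
    rw [show (n : ℤ) + (k - 1) = n + 1 + k - 2 by ring]
    exact h.sub_even even_two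

/-- For `i, j ≥ 0`, the number of `n`-step nonnegative paths from `i` to `j` with steps `±1`. -/
def numNonnegPaths (n : ℕ) (i j : ℤ) : ℤ := numFreePaths n (i - j) - numFreePaths n (i + j + 2)

theorem numNonnegPaths_succ (n : ℕ) (i j : ℤ) :
    numNonnegPaths (n + 1) i j = numNonnegPaths n (i + 1) j + numNonnegPaths n (i - 1) j := by
  simp only [numNonnegPaths, numFreePaths]
  ring_nf

theorem numNonnegPaths_succ_right (n : ℕ) (i j : ℤ) :
    numNonnegPaths (n + 1) i j = numNonnegPaths n i (j + 1) + numNonnegPaths n i (j - 1) := by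
  simp only [numNonnegPaths, numFreePaths]
  ring_nf

theorem numNonnegPaths_neg_left (n : ℕ) (i j : ℤ) :
    numNonnegPaths n (-2 - i) j = -numNonnegPaths n i j := by
  simp only [numNonnegPaths]
  rw [← numFreePaths_neg n (-2 - i - j), ← numFreePaths_neg n (-2 - i + j + 2)]
  ring_nf

theorem numNonnegPaths_neg_right (n : ℕ) (i j : ℤ) :
    numNonnegPaths n i (-2 - j) = -numNonnegPaths n i j := by
  simp only [numNonnegPaths]
  ring_nf

theorem numNonnegPaths_neg_one_left (n : ℕ) (j : ℤ) : numNonnegPaths n (-1) j = 0 := by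
  have := numNonnegPaths_neg_left n (-1) j
  norm_num at this
  omega

theorem numNonnegPaths_neg_one_right (n : ℕ) (i : ℤ) : numNonnegPaths n i (-1) = 0 := by
  have := numNonnegPaths_neg_right n i (-1)
  norm_num at this
  omega

theorem numNonnegPaths_zero_of_lt {n : ℕ} {j : ℤ} (h : (n : ℤ) < j) :
    numNonnegPaths n 0 j = 0 := by
  rw [numNonnegPaths, ← numFreePaths_neg, numFreePaths_of_lt (by omega),
    numFreePaths_of_lt (by omega), sub_zero]

theorem numNonnegPaths_of_odd {n : ℕ} {i j : ℤ} (h : Odd (n + i + j)) :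
    numNonnegPaths n i j = 0 := by
  rw [numNonnegPaths, numFreePaths_of_odd, numFreePaths_of_odd, sub_zero]
  · convert h.add_even even_two using 1; ring
  · rw [show (n : ℤ) + (i - j) = n + i + j - 2 * j by ring]
    exact h.sub_even (even_two_mul j)

theorem numNonnegPaths_zero_zero (m : ℕ) : numNonnegPaths (2 * m) 0 0 = catalan m := by
  have h1 := numFreePaths_eq_choose (2 * m) m
  have h2 := numFreePaths_eq_choose (2 * m) (m + 1)
  have e1 : (2 * m - (2 * m : ℕ) : ℤ) = 0 - 0 := by push_cast; ring
  have e2 : (2 * (m + 1 : ℕ) - (2 * m : ℕ) : ℤ) = 0 + 0 + 2 := by push_cast; ring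
  rw [e1] at h1
  rw [e2] at h2
  rw [numNonnegPaths, h1, h2]
  have h3 := Nat.choose_succ_right_eq (2 * m) m
  have h4 := succ_mul_catalan_eq_centralBinom m
  rw [Nat.centralBinom_eq_two_mul_choose] at h4
  rw [show 2 * m - m = m by omega] at h3
  zify at h3 h4
  have h5 : ((m : ℤ) + 1) * ((2 * m).choose m - (2 * m).choose (m + 1)) = (m + 1) * catalan m := by
    linear_combination -h3 - h4
  exact mul_left_cancel₀ (by positivity) h5

/-! ### Determinant formula and Catalan product. -/

theorem numGBWalks_eq_det {p : ℤ × ℤ} (hp : InGBWedge p) (n b : ℕ) :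
    (numGBWalks n p b : ℤ) =
      numNonnegPaths n (p.1 - p.2) b * numNonnegPaths n (p.1 + p.2 + 2) (b + 2) -
        numNonnegPaths n (p.1 - p.2) (b + 2) * numNonnegPaths n (p.1 + p.2 + 2) b := by
  induction n generalizing p with
  | zero =>
    obtain ⟨x, y⟩ := p
    rw [numGBWalks_zero hp]
    simp only [InGBWedge] at hp
    simp only [numNonnegPaths, numFreePaths, Prod.mk.injEq]
    split_ifs <;> omega
  | succ n ih =>
    -- A step may leave the wedge, but the determinant vanishes there: for `y = -1` its two starting
    -- points coincide, and for `x - y = -1` one of them is `-1`.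
    have ext : ∀ q : ℤ × ℤ, InGBWedge q ∨ q.2 = -1 ∨ q.1 - q.2 = -1 →
        (numGBWalks n q b : ℤ) =
          numNonnegPaths n (q.1 - q.2) b * numNonnegPaths n (q.1 + q.2 + 2) (b + 2) -
            numNonnegPaths n (q.1 - q.2) (b + 2) * numNonnegPaths n (q.1 + q.2 + 2) b := by
      rintro ⟨x, y⟩ (h | h | h)
      · exact ih h
      · obtain rfl : y = -1 := h
        rw [numGBWalks_of_not_inGBWedge (by simp [InGBWedge])]
        ring_nf
      · rw [numGBWalks_of_not_inGBWedge (by simp [InGBWedge] at *; omega), h,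
          numNonnegPaths_neg_one_left, numNonnegPaths_neg_one_left]
        simp
    obtain ⟨x, y⟩ := p
    rw [numGBWalks_succ hp]
    push_cast
    simp only [InGBWedge] at hp
    rw [ext _ (by simp [InGBWedge]; omega), ext _ (by simp [InGBWedge]; omega),
      ext _ (by simp [InGBWedge]; omega), ext _ (by simp [InGBWedge]; omega)]
    simp only [numNonnegPaths_succ, Prod.mk_add_mk]
    ring_nf

theorem numGBWalks_origin (n b : ℕ) :
    (numGBWalks n (0, 0) b : ℤ) =
      (numNonnegPaths n 0 b ^ 2 + numNonnegPaths n 0 b * numNonnegPaths n 0 (b + 4)) -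
        (numNonnegPaths n 0 (b + 2) ^ 2 +
          numNonnegPaths n 0 (b - 2) * numNonnegPaths n 0 (b + 2)) := by
  -- Expand the count of `n + 2` steps from `0` to `j` by its first two steps and by its last two.
  have two : ∀ j : ℤ, numNonnegPaths n 2 j =
      numNonnegPaths n 0 (j + 2) + numNonnegPaths n 0 j + numNonnegPaths n 0 (j - 2) := by
    intro j
    have h1 := numNonnegPaths_succ (n + 1) 0 j
    have h2 := numNonnegPaths_succ n (0 + 1) j
    have h3 := numNonnegPaths_succ_right (n + 1) 0 j
    have h4 := numNonnegPaths_succ_right n 0 (j + 1)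
    have h5 := numNonnegPaths_succ_right n 0 (j - 1)
    rw [zero_sub, numNonnegPaths_neg_one_left] at h1
    ring_nf at *
    linarith
  rw [numGBWalks_eq_det (by simp [InGBWedge])]
  simp only [sub_zero, zero_add, add_zero, two]
  ring_nf

theorem sum_numGBWalks_origin (n : ℕ) :
    (∑ b ∈ range (n + 1), numGBWalks n (0, 0) b : ℤ) =
      numNonnegPaths n 0 0 ^ 2 + numNonnegPaths n 0 1 ^ 2 +
        numNonnegPaths n 0 0 * numNonnegPaths n 0 2 := by
  set β : ℤ → ℤ := numNonnegPaths n 0 with hβ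
  have hneg : β (-1) = 0 := numNonnegPaths_neg_one_right n 0
  have hneg2 : β (-2) = -β 0 := by simpa using numNonnegPaths_neg_right n 0 0
  have htel : ∀ N : ℕ, (∑ b ∈ range N, numGBWalks n (0, 0) b : ℤ) =
      (β 0 ^ 2 + β 1 ^ 2 + β 0 * β 2) - β N ^ 2 - β (N + 1) ^ 2 + β (N - 2) * β (N + 2) +
        β (N - 1) * β (N + 3) := by
    intro N
    induction N with
    | zero => simp [hneg, hneg2]; ring
    | succ N ih =>
      rw [sum_range_succ, ih, numGBWalks_origin, ← hβ]
      push_cast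
      ring_nf
  have hzero : ∀ j : ℤ, (n : ℤ) < j → β j = 0 := fun j => numNonnegPaths_zero_of_lt
  -- At `N = n + 1` every boundary term has a factor whose endpoint is out of reach in `n` steps.
  rw [htel, hzero (n + 1 : ℕ) (by push_cast; omega), hzero ((n + 1 : ℕ) + 1) (by push_cast; omega),
    hzero ((n + 1 : ℕ) + 2) (by push_cast; omega), hzero ((n + 1 : ℕ) + 3) (by push_cast; omega)]
  ring

theorem sum_numGBWalks_origin_eq_catalan (n : ℕ) :
    ∑ b ∈ range (n + 1), numGBWalks n (0, 0) b = catalan ((n + 1) / 2) * catalan ((n + 2) / 2) := by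
  have h := sum_numGBWalks_origin n
  have h1 := numNonnegPaths_succ_right n 0 0
  have h2 := numNonnegPaths_succ_right (n + 1) 0 0
  have h3 := numNonnegPaths_succ_right n 0 1
  rw [zero_sub, numNonnegPaths_neg_one_right] at h1 h2
  norm_num at h1 h2 h3
  zify
  rw [h]
  obtain ⟨m, rfl | rfl⟩ := Nat.even_or_odd' n
  · have e1 : (2 * m + 1) / 2 = m := by omega
    have e2 : (2 * m + 2) / 2 = m + 1 := by omega
    rw [e1, e2, ← numNonnegPaths_zero_zero, ← numNonnegPaths_zero_zero, mul_add, mul_one, h2, h3,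
      numNonnegPaths_of_odd (j := 1) ⟨m, by push_cast; ring⟩]
    ring
  · have e1 : (2 * m + 1 + 1) / 2 = m + 1 := by omega
    have e2 : (2 * m + 1 + 2) / 2 = m + 1 := by omega
    rw [e1, e2, ← numNonnegPaths_zero_zero, mul_add, mul_one, h1,
      numNonnegPaths_of_odd (j := 0) ⟨m, by push_cast; ring⟩]
    ring

/-! ### Ballot permutations split by final height. -/

theorem ascDesHeight_zero_left {n : ℕ} (π : Equiv.Perm (Fin (n + 1))) (k : Fin (n + 1)) :
    ascDesHeight 0 π k = prefixAsc π (k + 1) - prefixDes π (k + 1) := by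
  simp only [ascDesHeight, prefixAsc, prefixDes, card_filter]
  rw [Fin.sum_univ_castSucc, Fin.sum_univ_castSucc]
  push_cast
  rw [if_neg (by simp), if_neg (by simp), add_zero, add_zero, zero_add, ← sum_sub_distrib]
  refine sum_congr rfl fun i _ => ?_
  have hne : π i.castSucc ≠ π i.succ := fun h => by
    simpa [Fin.ext_iff] using π.injective h
  have hs : ∀ h : i.val + 1 < n + 1, (⟨i.val + 1, h⟩ : Fin (n + 1)) = i.succ := fun _ => rfl
  rcases lt_or_gt_of_ne hne with h | h <;>
    simp [hs, h, h.not_gt, apply_ite Neg.neg]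

theorem isBallotPerm_iff {n : ℕ} (π : Equiv.Perm (Fin (n + 1))) :
    IsBallotPerm π ↔ ∀ k : Fin (n + 1), 0 ≤ ascDesHeight 0 π k := by
  simp only [ascDesHeight_zero_left, sub_nonneg, Nat.cast_le]
  constructor
  · exact fun h k => h _ k.isLt
  · rintro h (_ | k) hk
    · simp [prefixDes]
    · exact h ⟨k, hk⟩

theorem ascDesHeight_le {n : ℕ} (h : ℕ) (π : Equiv.Perm (Fin (n + 1))) (k : Fin (n + 1)) :
    ascDesHeight h π k ≤ h + n := by
  rw [ascDesHeight]
  gcongr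
  refine (sum_le_card_nsmul univ _ 1 fun i _ => ?_).trans (by simp)
  split_ifs <;> norm_num

theorem ballotPerms231_succ (n : ℕ) :
    ballotPerms231 (n + 1) = ⋃ b ∈ range (n + 1), hbBallotPerms231 n 0 b := by
  ext π
  simp only [ballotPerms231, hbBallotPerms231, Set.mem_ofPred_eq, Set.mem_iUnion, isBallotPerm_iff,
    IsHBBallotPerm, mem_range, exists_prop]
  constructor
  · rintro ⟨h, hav⟩
    have h1 := h (Fin.last n)
    have h2 := ascDesHeight_le 0 π (Fin.last n)
    push_cast at h2
    exact ⟨(ascDesHeight 0 π (Fin.last n)).toNat, by omega, ⟨h, (Int.toNat_of_nonneg h1).symm⟩, hav⟩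
  · rintro ⟨b, -, ⟨h, -⟩, hav⟩
    exact ⟨h, hav⟩

theorem ncard_ballotPerms231_succ (n : ℕ) :
    (ballotPerms231 (n + 1)).ncard = ∑ b ∈ range (n + 1), (hbBallotPerms231 n 0 b).ncard := by
  classical
  have h : ∀ b, (hbBallotPerms231 n 0 b).ncard = #(hbBallotPerms231 n 0 b).toFinset := fun b =>
    Set.ncard_eq_toFinset_card' _
  simp only [h]
  rw [← card_biUnion, ballotPerms231_succ, ← Set.ncard_coe_finset]
  · simp
  · intro b _ c _ hbc
    rw [Function.onFun, Set.disjoint_toFinset, Set.disjoint_left]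
    rintro π ⟨⟨-, hb⟩, -⟩ ⟨⟨-, hc⟩, -⟩
    exact hbc (by exact_mod_cast hb.symm.trans hc)

theorem theorem4p5 :
    (∀ n h b : ℕ, (hbBallotPerms231 n h b).encard = (gbWalks n h b).encard) ∧
      ∀ n : ℕ, (ballotPerms231 n).ncard = catalan (n / 2) * catalan ((n + 1) / 2) := by
  refine ⟨fun n h b => ?_, fun n => ?_⟩
  · rw [encard_gbWalks, ← ncard_hbBallotPerms231, Set.Finite.cast_ncard_eq (Set.toFinite _)]
  · cases n with
    | zero =>
      have : ballotPerms231 0 = Set.univ :=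
        Set.eq_univ_of_forall fun π => ⟨fun k _ => by simp [prefixDes],
          (avoidsPattern231_iff π).2 fun i => i.elim0⟩
      simp [this, Set.ncard_univ]
    | succ n =>
      rw [ncard_ballotPerms231_succ, ← sum_numGBWalks_origin_eq_catalan]
      simp [ncard_hbBallotPerms231]
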